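/- Let $\alpha,\gamma\in\mathbb R$ and let $\sigma_d=\{(z_k,c_k)\}_{k=1}^N$ with distinct $z_k$, $\operatorname{Im}z_k>0$, $c_k\in\mathbb C\setminus\{0\}$. Put $\theta(z)=\frac xt z+2z^2+\alpha z-\frac{\gamma}{2}$ and $z_0=-\frac14\left(\frac xt+\alpha\right)$, so that $|e^{2it\theta(z)}|=e^{-8t(\operatorname{Re}z-z_0)\operatorname{Im}z}$. For $\triangle\subseteq K\subseteq\{1,\dots,N\}$ and data $\sigma=\{(z_k,c_k)\}_{k\in K}$, let $s_\triangle(z)=\prod_{k\in\triangle}\frac{z-z_k}{z-z_k^*}$ and let $M^{\triangle}(z|\sigma)=M^{\triangle}(x,t;z|\sigma)$ be the $2\times2$ matrix function that is analytic off $\{z_k,z_k^*:k\in K\}$, satisfies $M^\triangle=I+O(z^{-1})$ as $z\to\infty$, and has at most simple poles at $z_k,z_k^*$ ($k\in K$) with $$\operatorname*{Res}_{z=z_k}M^\triangle=\lim_{z\to z_k}M^\triangle N_k^\triangle,\qquad \operatorname*{Res}_{z=z_k^*}M^\triangle=\lim_{z\to z_k^*}M^\triangle\,\sigma_2\,(N_k^{\triangle})^{*}\sigma_2,\qquad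 \sigma_2=\begin{pmatrix}0&-i\\ i&0\end{pmatrix}$$ ($^*$ is entrywise complex conjugation), where $$N_k^\triangle=\begin{pmatrix}0&c_k^{-1}s_\triangle'(z_k)^{-2}e^{-2it\theta(z_k)}\\0&0\end{pmatrix}\ (k\in\triangle),\qquad N_k^\triangle=\begin{pmatrix}0&0\\c_k\,s_\triangle(z_k)^2e^{2it\theta(z_k)}&0\end{pmatrix}\ (k\notin\triangle).$$ ($M^\triangle$ is the reflectionless solution $M^{\varnothing}$ with the poles redistributed between its columns: $M^{\triangle}=M^{\varnothing}\operatorname{diag}(s_\triangle,s_\triangle^{-1})$.) Fix $x_1<x_2$, $v_1<v_2$, let $S=\{(x,t):x=x_0+vt,\ x_0\in[x_1,x_2],\ v\in[v_1,v_2]\}$, $\mathcal I=\left[-\frac{v_2+\alpha}{4},-\frac{v_1+\alpha}{4}\right]$ (the values of $z_0$ for $x/t\in[v_1,v_2]$), $K(\mathcal I)=\{k:\operatorname{Re}z_k\in\mathcal I\}$ and $\mu=\min_{k\notin K(\mathcal I)}\operatorname{Im}(z_k)\operatorname{dist}(\operatorname{Re}z_k,\mathcal I)$ (with $e^{-8\mu|t|}:=0$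 if every pole has real part in $\mathcal I$). Let $$\triangle^-_{z_0}=\{k:\operatorname{Re}z_k<z_0\},\quad \triangle^+_{z_0}=\{k:\operatorname{Re}z_k>z_0\},\quad \triangle^\pm_{z_0}(\mathcal I)=\triangle^\pm_{z_0}\cap K(\mathcal I),$$ $$\hat\sigma_d^{\mp}(\mathcal I)=\{(z_k,c_k^{\mp}(\mathcal I))\}_{k\in K(\mathcal I)},\qquad c_k^{\mp}(\mathcal I)=c_k\prod_{j\in\triangle^{\mp}(\mathcal I)}\left(\frac{z_k-z_j}{z_k-z_j^*}\right)^2,$$ with $\triangle^-(\mathcal I)=\{j:\operatorname{Re}z_j<-\frac{v_2+\alpha}4\}$ and $\triangle^+(\mathcal I)=\{j:\operatorname{Re}z_j>-\frac{v_1+\alpha}4\}$. Then, for $(x,t)\in S$ with $|t|$ large enough, $M^{\triangle^{\mp}_{z_0}}(z|\sigma_d)$ and $M^{\triangle^{\mp}_{z_0}(\mathcal I)}(z|\hat\sigma^{\mp}_d(\mathcal I))$ exist, and as $t\to\pm\infty$ with $(x,t)\in S$, $$M^{\triangle^{\mp}_{z_0}}(z|\sigma_d)=\bigl(I+O(e^{-8\mu|t|})\bigr)\,M^{\triangle^{\mp}_{z_0}(\mathcal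 I)}(z|\hat\sigma^{\mp}_d(\mathcal I)),$$ with upper signs for $t\to+\infty$ and lower signs for $t\to-\infty$. For each $r>0$ the error term is uniform in $(x,t)\in S$ and in all $z$ which are not poles $z_k,z_k^*$, $k\in K(\mathcal I)$, and have distance at least $r$ from all $z_k,z_k^*$ with $k\notin K(\mathcal I)$. In words: after the poles are redistributed, only the $|K(\mathcal I)|$ solitons travelling in the cone survive, up to exponentially small errors. -/

import Mathlib

open Filter Topology Asymptotics

noncomputable section

namespace CGNLS

/-- The phase `θ(w) = (x/t) w + 2 w² + α w - γ/2` (used for `t ≠ 0` only). -/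
def theta (α γ x t : ℝ) (w : ℂ) : ℂ :=
  w * ((x : ℂ) / (t : ℂ)) + 2 * w ^ 2 + (α : ℂ) * w - (γ : ℂ) / 2

/-- The stationary point `z₀ = -(x/t + α)/4` of the phase. -/
def statPoint (α x t : ℝ) : ℝ := -(x / t + α) / 4

/-- The space-time cone `S(x₁,x₂,v₁,v₂)`. -/
def cone (x₁ x₂ v₁ v₂ : ℝ) : Set (ℝ × ℝ) :=
  {p | ∃ x₀ ∈ Set.Icc x₁ x₂, ∃ v ∈ Set.Icc v₁ v₂, p.1 = x₀ + v * p.2}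

/-- The interval `I` swept out by the stationary point `-(v + α)/4` as the velocity `v = x/t` runs
over `[v₁, v₂]`; equivalently, the real parts of the poles whose solitons have velocity
`-(4 Re z + α)` in `[v₁, v₂]`. -/
def window (α v₁ v₂ : ℝ) : Set ℝ := Set.Icc (-(v₂ + α) / 4) (-(v₁ + α) / 4)

section Poles

variable {N : ℕ}

open scoped Classical in
/-- Indices of the poles with real part in `I`. -/
def inside (z : Fin N → ℂ) (I : Set ℝ) : Finset (Fin N) :=
  Finset.univ.filter fun k => (z k).re ∈ I

/-- Indices of the poles with real part outside `I`. -/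
def outside (z : Fin N → ℂ) (I : Set ℝ) : Finset (Fin N) := (inside z I)ᶜ

open scoped Classical in
/-- Indices of the poles with real part `< a`. -/
def leftOf (z : Fin N → ℂ) (a : ℝ) : Finset (Fin N) :=
  Finset.univ.filter fun k => (z k).re < a

open scoped Classical in
/-- Indices of the poles with real part `> b`. -/
def rightOf (z : Fin N → ℂ) (b : ℝ) : Finset (Fin N) :=
  Finset.univ.filter fun k => b < (z k).re

open scoped Classical in
/-- The factor `exp(-8 μ(I) |t|)`, where `μ(I)` is the minimum of `Im z_k * dist(Re z_k, I)` over
the poles outside `I`. If there is no such pole, then `μ(I) = ∞` and the factor is `0`. -/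
def decay (z : Fin N → ℂ) (I : Set ℝ) (t : ℝ) : ℝ :=
  if h : (outside z I).Nonempty then
    Real.exp (-8 * (outside z I).inf' h (fun k => (z k).im * Metric.infDist (z k).re I) * |t|)
  else 0

/-- The product `∏ (w - z_k)/(w - z_k^*)` over `k ∈ D`. -/
def blaschke (z : Fin N → ℂ) (D : Finset (Fin N)) (w : ℂ) : ℂ :=
  ∏ k ∈ D, (w - z k) / (w - (starRingEnd ℂ) (z k))

/-- Norming constants multiplied by the squared factors of the poles indexed by `J`:
`c_k ∏_{j ∈ J} ((z_k - z_j)/(z_k - z_j^*))²`. -/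
def modifiedNorming (z c : Fin N → ℂ) (J : Finset (Fin N)) (k : Fin N) : ℂ :=
  c k * ∏ j ∈ J, ((z k - z j) / (z k - (starRingEnd ℂ) (z j))) ^ 2

/-- The residue coefficient at `z_k` of the problem normalized by `D`. -/
def residueCoeff (α γ x t : ℝ) (z c : Fin N → ℂ) (D : Finset (Fin N)) (k : Fin N) : ℂ :=
  if k ∈ D then
    (c k)⁻¹ * ((deriv (blaschke z D) (z k)) ^ 2)⁻¹
      * Complex.exp (-2 * Complex.I * t * theta α γ x t (z k))
  else
    c k * (blaschke z D (z k)) ^ 2 * Complex.exp (2 * Complex.I * t * theta α γ x t (z k))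

/-- The nilpotent residue matrix at `z_k`: upper triangular for `k ∈ D`, otherwise lower. -/
def residueMatrix (α γ x t : ℝ) (z c : Fin N → ℂ) (D : Finset (Fin N)) (k : Fin N) :
    Matrix (Fin 2) (Fin 2) ℂ :=
  if k ∈ D then !![0, residueCoeff α γ x t z c D k; 0, 0]
  else !![0, 0; residueCoeff α γ x t z c D k, 0]

/-- The second Pauli matrix. -/
def sigma2 : Matrix (Fin 2) (Fin 2) ℂ := !![0, -Complex.I; Complex.I, 0]

/-- The poles indexed by `K` and their complex conjugates. -/
def poleSet (z : Fin N → ℂ) (K : Finset (Fin N)) : Set ℂ :=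
  {w | ∃ k ∈ K, w = z k ∨ w = (starRingEnd ℂ) (z k)}

/-- `M` has at most a simple pole at `p` and `Res_{w = p} M = lim_{w → p} M(w) A`. -/
def HasResidueCondition (M : ℂ → Matrix (Fin 2) (Fin 2) ℂ) (p : ℂ)
    (A : Matrix (Fin 2) (Fin 2) ℂ) : Prop :=
  ∃ R : Matrix (Fin 2) (Fin 2) ℂ,
    Tendsto (fun w => (w - p) • M w) (𝓝[≠] p) (𝓝 R) ∧
    Tendsto (fun w => M w * A) (𝓝[≠] p) (𝓝 R)

/-- `M` solves, at the point `(x,t)`, the reflectionless Riemann-Hilbert problem with scattering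
data `{(z_k, c_k) : k ∈ K}` normalized by the index set `D ⊆ K`. The case `D = ∅` is the
unnormalized problem. Values of `M` at the poles themselves are irrelevant. -/
structure IsSolution (α γ x t : ℝ) (z c : Fin N → ℂ) (K D : Finset (Fin N))
    (M : ℂ → Matrix (Fin 2) (Fin 2) ℂ) : Prop where
  analytic : ∀ i j, DifferentiableOn ℂ (fun w => M w i j) (poleSet z K)ᶜ
  normalized : ∀ i j, (fun w => M w i j - (1 : Matrix (Fin 2) (Fin 2) ℂ) i j)
    =O[Bornology.cobounded ℂ] (fun w : ℂ => w⁻¹)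
  residue : ∀ k ∈ K, HasResidueCondition M (z k) (residueMatrix α γ x t z c D k)
  residue_conj : ∀ k ∈ K, HasResidueCondition M ((starRingEnd ℂ) (z k))
    (sigma2 * (residueMatrix α γ x t z c D k).map (starRingEnd ℂ) * sigma2)

/-- The points that are no kept pole and have distance at least `r` from all discarded poles
(poles always together with their conjugates; `K` indexes the kept ones). -/
def awayFrom (z : Fin N → ℂ) (K : Finset (Fin N)) (r : ℝ) : Set ℂ :=
  {w | w ∉ poleSet z K ∧ ∀ p ∈ poleSet z Kᶜ, r ≤ ‖w - p‖}

/-- With `K` the set of indices of the poles in `I`: the problem with all poles, data `c` and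
normalization `D`, and the problem with only the poles in `I`, data `c'` and normalization
`D ∩ K`, are both solvable at `(x,t)`, and their solutions satisfy `M = (1 + E) M'` with the
entries of `E` bounded by `ε` at distance `≥ r` from the discarded poles. -/
def ReducesTo (α γ x t : ℝ) (z c : Fin N → ℂ) (D : Finset (Fin N)) (I : Set ℝ) (c' : Fin N → ℂ)
    (r ε : ℝ) : Prop :=
  (∃ M, IsSolution α γ x t z c Finset.univ D M) ∧
  (∃ M', IsSolution α γ x t z c' (inside z I) (D ∩ inside z I) M') ∧
  ∀ M M', IsSolution α γ x t z c Finset.univ D M →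
    IsSolution α γ x t z c' (inside z I) (D ∩ inside z I) M' →
    ∀ w ∈ awayFrom z (inside z I) r, ∃ E : Matrix (Fin 2) (Fin 2) ℂ,
      (∀ i j, ‖E i j‖ ≤ ε) ∧ M w = (1 + E) * M' w

end Poles

end CGNLS

end

/-! The redistribution by `D` only decides which of `z_k, z_k^*` is a pole of the first column; call
that point `p_k`. Then every row of a solution is a pair `(a, b)` of sums of simple fractions, `a`
with poles `p_k` and `b` with poles `p_k^*`, whose residues are `η_k b(p_k)` and `-η_k^* a(p_k^*)`.
The problem is thus a finite linear system for the residues.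

The main tool is the Wronskian `a b' - b a'` of two rows belonging to coefficients `η` and `η'`. Its
residue at `p_k` is `(η_k - η'_k) b(p_k) b'(p_k)`, and similarly at `p_k^*`, so it is a constant
plus terms that only see the difference of the coefficients (`RowSolves.wronskian`). This is used
three times. For a homogeneous solution and its partner `(-b^*, a^*)` it gives `|a|^2 + |b|^2 = 0`
on the real line, hence unique solvability for all `η` and, by compactness, bounds uniform for
bounded `η`. For the two rows of one solution it gives determinant 1. For the rows of `M` and `M'`
it gives the entries of `M M'⁻¹`: kept poles contribute nothing, which is why the error is uniform
up to them, and each discarded pole contributes `O(|η_k|)` (`exists_reduction_bound`).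

It remains to see that the discarded coefficients are small. If `D` is adapted to the sign of `t (Re
z_k - z_0)`, all exponentials decay, and in the cone `z_0` is within `O(1/|t|)` of the window, which
costs only a constant factor against `e^{-8μ|t|}` (`exists_reducesTo`). The discarded factors of the
Blaschke product survive in the norming constants (`residueCoeff_inter`). -/

noncomputable section

namespace CGNLS

open ComplexConjugate

/-! ### Sums of simple fractions and removable singularities -/

section Cauchy

variable {ι : Type*} [Fintype ι]

/-- The rational function `δ + ∑ A_k / (w - p_k)`. -/
def cauchy (δ : ℂ) (p A : ι → ℂ) (w : ℂ) : ℂ := δ + ∑ k, A k / (w - p k)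

/-- Partial fractions of a product of two functions with simple poles at different points. -/
theorem cauchy_mul {p q : ι → ℂ} (hpq : ∀ j k, p j ≠ q k) (f g : ℂ) (F G : ι → ℂ) {w : ℂ}
    (hp : ∀ k, w ≠ p k) (hq : ∀ k, w ≠ q k) :
    cauchy f p F w * cauchy g q G w = f * g + ∑ k, F k * cauchy g q G (p k) / (w - p k)
      + ∑ k, G k * cauchy f p F (q k) / (w - q k) := by
  have key : (∑ k, F k / (w - p k)) * (∑ k, G k / (w - q k)) =
      ∑ j, ∑ k, F j * (G k / (p j - q k)) / (w - p j)
        + ∑ k, ∑ j, G k * (F j / (q k - p j)) / (w - q k) := by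
    rw [Finset.sum_comm (γ := ι) (f := fun k j => G k * (F j / (q k - p j)) / (w - q k)),
      Finset.sum_mul_sum, ← Finset.sum_add_distrib]
    refine Finset.sum_congr rfl fun j _ => ?_
    rw [← Finset.sum_add_distrib]
    refine Finset.sum_congr rfl fun k _ => ?_
    have h1 := sub_ne_zero.2 (hp j)
    have h2 := sub_ne_zero.2 (hq k)
    have h3 := sub_ne_zero.2 (hpq j k)
    have h4 : q k - p j = -(p j - q k) := by ring
    rw [h4]
    field_simp
    ring
  have e1 : ∑ k, F k * cauchy g q G (p k) / (w - p k) = g * ∑ k, F k / (w - p k)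
      + ∑ j, ∑ k, F j * (G k / (p j - q k)) / (w - p j) := by
    rw [Finset.mul_sum, ← Finset.sum_add_distrib]
    refine Finset.sum_congr rfl fun k _ => ?_
    rw [← Finset.sum_div, ← Finset.mul_sum, cauchy]
    ring
  have e2 : ∑ k, G k * cauchy f p F (q k) / (w - q k) = f * ∑ k, G k / (w - q k)
      + ∑ k, ∑ j, G k * (F j / (q k - p j)) / (w - q k) := by
    rw [Finset.mul_sum, ← Finset.sum_add_distrib]
    refine Finset.sum_congr rfl fun k _ => ?_
    rw [← Finset.sum_div, ← Finset.mul_sum, cauchy]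
    ring
  rw [e1, e2]
  simp only [cauchy]
  linear_combination key

theorem conj_cauchy (δ : ℂ) (p A : ι → ℂ) (w : ℂ) :
    conj (cauchy δ p A w) = cauchy (conj δ) (conj ∘ p) (conj ∘ A) (conj w) := by
  simp [cauchy]

theorem norm_cauchy_le {δ : ℂ} (p : ι → ℂ) {A : ι → ℂ} (w : ℂ) {C : ℝ} (hδ : ‖δ‖ ≤ 1)
    (hA : ∀ k, ‖A k‖ ≤ C) : ‖cauchy δ p A w‖ ≤ 1 + C * ∑ k, ‖w - p k‖⁻¹ := by
  refine (norm_add_le _ _).trans (add_le_add hδ ((norm_sum_le _ _).trans ?_))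
  rw [Finset.mul_sum]
  refine Finset.sum_le_sum fun k _ => ?_
  rw [norm_div, div_eq_mul_inv]
  exact mul_le_mul_of_nonneg_right (hA k) (by positivity)

theorem differentiableAt_cauchy (δ : ℂ) {p A : ι → ℂ} {w : ℂ}
    (h : ∀ k, A k = 0 ∨ w ≠ p k) : DifferentiableAt ℂ (cauchy δ p A) w := by
  unfold cauchy
  refine (differentiableAt_const _).add (DifferentiableAt.fun_sum fun k _ => ?_)
  rcases h k with h | h
  · simp [h]
  · exact (differentiableAt_const _).div (by fun_prop) (sub_ne_zero.2 h)

theorem tendsto_sub_mul_cauchy_of_ne (δ : ℂ) {p : ι → ℂ} (A : ι → ℂ) {u : ℂ}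
    (h : ∀ k, u ≠ p k) : Tendsto (fun w => (w - u) * cauchy δ p A w) (𝓝[≠] u) (𝓝 0) := by
  have h1 : ContinuousAt (fun w => (w - u) * cauchy δ p A w) u :=
    (by fun_prop : ContinuousAt (fun w : ℂ => w - u) u).mul
      (differentiableAt_cauchy δ fun k => Or.inr (h k)).continuousAt
  simpa using h1.tendsto.mono_left nhdsWithin_le_nhds

theorem tendsto_sub_mul_cauchy (δ : ℂ) {p : ι → ℂ} (hp : Function.Injective p) (A : ι → ℂ)
    (k : ι) : Tendsto (fun w => (w - p k) * cauchy δ p A w) (𝓝[≠] (p k)) (𝓝 (A k)) := by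
  classical
  -- With its `k`-th coefficient set to zero, the sum is regular at `p k`.
  have h0 : DifferentiableAt ℂ (cauchy δ p (Function.update A k 0)) (p k) := by
    refine differentiableAt_cauchy δ fun j => ?_
    by_cases h : j = k
    · simp [h]
    · exact Or.inr fun h' => h (hp h'.symm)
  have h1 : ContinuousAt (fun w => (w - p k) * cauchy δ p (Function.update A k 0) w + A k) (p k) :=
    ((by fun_prop : ContinuousAt (fun w : ℂ => w - p k) (p k)).mul h0.continuousAt).add
      continuousAt_const
  have h2 : Tendsto (fun w => (w - p k) * cauchy δ p (Function.update A k 0) w + A k)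
      (𝓝[≠] (p k)) (𝓝 (A k)) := by
    simpa using h1.tendsto.mono_left nhdsWithin_le_nhds
  refine h2.congr' ?_
  filter_upwards [self_mem_nhdsWithin] with w hw
  have hw' : w - p k ≠ 0 := sub_ne_zero.2 hw
  have : cauchy δ p A w = cauchy δ p (Function.update A k 0) w + A k / (w - p k) := by
    have := Finset.sum_erase_add (Finset.univ : Finset ι) (fun j => A j / (w - p j))
      (Finset.mem_univ k)
    have h3 := Finset.sum_erase_add (Finset.univ : Finset ι)
      (fun j => Function.update A k 0 j / (w - p j)) (Finset.mem_univ k)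
    have h4 : ∑ j ∈ Finset.univ.erase k, Function.update A k 0 j / (w - p j) =
        ∑ j ∈ Finset.univ.erase k, A j / (w - p j) := Finset.sum_congr rfl fun j hj => by
      rw [Function.update_of_ne (Finset.ne_of_mem_erase hj)]
    rw [cauchy, cauchy, ← this, ← h3, h4]
    simp [add_assoc]
  rw [this]
  field_simp

theorem cauchy_sub_isBigO (δ : ℂ) (p A : ι → ℂ) :
    (fun w => cauchy δ p A w - δ) =O[Bornology.cobounded ℂ] (fun w : ℂ => w⁻¹) := by
  simp only [cauchy, add_sub_cancel_left]
  refine IsBigO.fun_sum fun k _ => ?_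
  simp only [div_eq_mul_inv]
  refine IsBigO.const_mul_left (IsBigO.of_bound 2 ?_) _
  filter_upwards [(tendsto_norm_cobounded_atTop (E := ℂ)).eventually_gt_atTop (2 * ‖p k‖)]
    with w hw
  have h1 : ‖w‖ / 2 ≤ ‖w - p k‖ := by linarith [norm_sub_norm_le w (p k)]
  have h0 : 0 < ‖w‖ := lt_of_le_of_lt (by positivity) hw
  rw [norm_inv, norm_inv]
  calc ‖w - p k‖⁻¹ ≤ (‖w‖ / 2)⁻¹ := inv_anti₀ (by positivity) h1
    _ = 2 * ‖w‖⁻¹ := by rw [inv_div]; rfl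

theorem cauchy_tendsto (δ : ℂ) (p A : ι → ℂ) :
    Tendsto (fun w => cauchy δ p A w - δ) (Bornology.cobounded ℂ) (𝓝 0) :=
  (cauchy_sub_isBigO δ p A).trans_tendsto tendsto_inv₀_cobounded

/-- A function with removable singularities only that vanishes at infinity is zero. -/
theorem eq_zero_of_removable (S : Finset ℂ) : ∀ (f : ℂ → ℂ), DifferentiableOn ℂ f (↑S)ᶜ →
    (∀ u ∈ S, Tendsto (fun w => (w - u) * f w) (𝓝[≠] u) (𝓝 0)) →
    Tendsto f (Bornology.cobounded ℂ) (𝓝 0) → ∀ w ∉ S, f w = 0 := by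
  classical
  induction S using Finset.induction_on with
  | empty =>
    intro f hf _ h0 w _
    have hf' : Differentiable ℂ f := by simpa [differentiableOn_univ] using hf
    exact hf'.apply_eq_of_tendsto_cocompact w (by rwa [← Metric.cobounded_eq_cocompact])
  | insert u S hu ih =>
    intro f hf hres h0 w hw
    have hopen : (↑S : Set ℂ)ᶜ ∈ 𝓝 u := S.finite_toSet.isClosed.isOpen_compl.mem_nhds hu
    -- Fill in the value at `u` by Riemann's theorem; this removes one point from the exceptional
    -- set.
    have hd : DifferentiableOn ℂ (Function.update f u (limUnder (𝓝[≠] u) f)) (↑S)ᶜ := by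
      refine Complex.differentiableOn_update_limUnder_of_isLittleO hopen ?_ ?_
      · refine hf.mono fun v hv => ?_
        simp only [Set.mem_sdiff, Set.mem_singleton_iff, Set.mem_compl_iff] at hv
        simp [hv.1, hv.2]
      · have h1 : Tendsto (fun w => (w - u) * (f w - f u)) (𝓝[≠] u) (𝓝 0) := by
          have h2 := hres u (Finset.mem_insert_self _ _)
          have h3 : Tendsto (fun w => (w - u) * f u) (𝓝[≠] u) (𝓝 0) := by
            have : ContinuousAt (fun w => (w - u) * f u) u := by fun_prop
            simpa using this.tendsto.mono_left nhdsWithin_le_nhds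
          simpa [mul_sub] using h2.sub h3
        rw [isLittleO_iff_tendsto']
        · refine h1.congr fun v => ?_
          rw [div_inv_eq_mul, mul_comm]
        · filter_upwards [self_mem_nhdsWithin] with v hv h
          exact absurd (inv_eq_zero.1 h) (sub_ne_zero.2 hv)
    have hwu : w ≠ u := fun h => hw (by simp [h])
    have hwS : w ∉ S := fun h => hw (by simp [h])
    have := ih _ hd ?_ ?_ w hwS
    · rwa [Function.update_of_ne hwu] at this
    · intro v hv
      have hvu : v ≠ u := fun h => hu (h ▸ hv)
      refine (hres v (Finset.mem_insert_of_mem hv)).congr' ?_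
      filter_upwards [mem_nhdsWithin_of_mem_nhds (isOpen_ne.mem_nhds hvu)] with y hy
      rw [Function.update_of_ne hy]
    · refine h0.congr' ?_
      have : ({u}ᶜ : Set ℂ) ∈ Bornology.cobounded ℂ :=
        Bornology.isBounded_def.1 Bornology.isBounded_singleton
      filter_upwards [this] with y hy
      rw [Function.update_of_ne hy]

end Cauchy

/-! ### The linear system for the residues of a row -/

section RowSystem

variable {ι : Type*}

/-- The points `p_k` are distinct, and distinct from all `p_j^*`. -/
structure Separated (p : ι → ℂ) : Prop where
  injective : Function.Injective p
  ne_conj : ∀ j k, p j ≠ conj (p k)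

theorem Separated.conj {p : ι → ℂ} (hp : Separated p) : Separated (conj ∘ p) where
  injective := (starRingEnd ℂ).injective.comp hp.injective
  ne_conj j k h := hp.ne_conj k j (by simpa using h.symm)

variable [Fintype ι]

/-- The residues of the row `(cauchy δ₁ p A, cauchy δ₂ p^* B)` satisfy
`A_k = η_k b(p_k)` and `B_k = -η_k^* a(p_k^*)`. -/
structure RowSolves (p η : ι → ℂ) (δ₁ δ₂ : ℂ) (A B : ι → ℂ) : Prop where
  left : ∀ k, A k = η k * cauchy δ₂ (conj ∘ p) B (p k)
  right : ∀ k, B k = -conj (η k) * cauchy δ₁ p A (conj (p k))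

/-- Both products have simple poles only, because the poles of the two columns are disjoint. The row
equations turn the residues of the difference into multiples of `η k - η' k` and its conjugate, so
equal coefficients cancel. -/
theorem RowSolves.wronskian {p η η' : ι → ℂ} (hp : Separated p) {δ₁ δ₂ δ₁' δ₂' : ℂ}
    {A B A' B' : ι → ℂ} (h : RowSolves p η δ₁ δ₂ A B) (h' : RowSolves p η' δ₁' δ₂' A' B') {w : ℂ}
    (h1 : ∀ k, w ≠ p k) (h2 : ∀ k, w ≠ conj (p k)) :
    cauchy δ₁ p A w * cauchy δ₂' (conj ∘ p) B' w - cauchy δ₂ (conj ∘ p) B w * cauchy δ₁' p A' w =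
      δ₁ * δ₂' - δ₂ * δ₁' +
      ∑ k, ((η k - η' k) * (cauchy δ₂ (conj ∘ p) B (p k) * cauchy δ₂' (conj ∘ p) B' (p k))
          / (w - p k)
        + conj (η k - η' k) * (cauchy δ₁ p A (conj (p k)) * cauchy δ₁' p A' (conj (p k)))
          / (w - conj (p k))) := by
  rw [cauchy_mul (q := conj ∘ p) hp.ne_conj _ _ _ _ h1 h2, mul_comm (cauchy δ₂ _ B w),
    cauchy_mul (q := conj ∘ p) hp.ne_conj _ _ _ _ h1 h2]
  have e : ∀ k, (η k - η' k) * (cauchy δ₂ (conj ∘ p) B (p k) * cauchy δ₂' (conj ∘ p) B' (p k))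
          / (w - p k)
        + conj (η k - η' k) * (cauchy δ₁ p A (conj (p k)) * cauchy δ₁' p A' (conj (p k)))
          / (w - conj (p k)) = A k * cauchy δ₂' (conj ∘ p) B' (p k) / (w - p k)
      + B' k * cauchy δ₁ p A (conj (p k)) / (w - conj (p k))
      - (A' k * cauchy δ₂ (conj ∘ p) B (p k) / (w - p k)
      + B k * cauchy δ₁' p A' (conj (p k)) / (w - conj (p k))) := by
    intro k
    rw [h.left, h.right, h'.left, h'.right, map_sub]
    ring
  rw [Finset.sum_congr rfl fun k _ => e k]
  simp only [Finset.sum_sub_distrib, Finset.sum_add_distrib, Function.comp_apply]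
  ring

/-- Clearing denominators gives a polynomial with infinitely many roots, and its value at `p k` is
`A k` times a nonzero product. Real points avoid all poles since `p k ≠ conj (p k)`. -/
theorem eq_zero_of_cauchy_ofReal {p A : ι → ℂ} (hp : Separated p)
    (h : ∀ s : ℝ, cauchy 0 p A s = 0) : A = 0 := by
  classical
  let P : Polynomial ℂ := ∑ k, Polynomial.C (A k) *
    ∏ j ∈ Finset.univ.erase k, (Polynomial.X - Polynomial.C (p j))
  have hne : ∀ (s : ℝ) k, (s : ℂ) - p k ≠ 0 := fun s k h0 =>
    hp.ne_conj k k (by rw [← sub_eq_zero.1 h0, Complex.conj_ofReal])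
  have hev : ∀ s : ℝ, P.eval (s : ℂ) = 0 := by
    intro s
    have : P.eval (s : ℂ) = (∏ j, ((s : ℂ) - p j)) * cauchy 0 p A s := by
      simp only [P, cauchy, zero_add, Finset.mul_sum, Polynomial.eval_finsetSum,
        Polynomial.eval_mul, Polynomial.eval_C, Polynomial.eval_prod, Polynomial.eval_sub,
        Polynomial.eval_X]
      refine Finset.sum_congr rfl fun k _ => ?_
      rw [← Finset.mul_prod_erase _ _ (Finset.mem_univ k)]
      field_simp [hne s k]
    rw [this, h, mul_zero]
  have hP : P = 0 := Polynomial.eq_zero_of_infinite_isRoot _ <|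
    (Set.infinite_range_of_injective Complex.ofReal_injective).mono <| by
      rintro _ ⟨s, rfl⟩
      exact hev s
  funext k
  have h0 : P.eval (p k) = 0 := by rw [hP, Polynomial.eval_zero]
  simp only [P, Polynomial.eval_finsetSum, Polynomial.eval_mul, Polynomial.eval_C,
    Polynomial.eval_prod, Polynomial.eval_sub, Polynomial.eval_X] at h0
  rw [Finset.sum_eq_single k] at h0
  · refine (mul_eq_zero.1 h0).resolve_right (Finset.prod_ne_zero_iff.2 fun j hj => ?_)
    exact sub_ne_zero.2 fun h' => Finset.ne_of_mem_erase hj (hp.injective h'.symm)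
  · intro j _ hj
    rw [Finset.prod_eq_zero (Finset.mem_erase.2 ⟨hj.symm, Finset.mem_univ k⟩) (sub_self _),
      mul_zero]
  · simp

/-- The symmetric partner `(-b^*, a^*)` of a row `(a, b)`. -/
theorem RowSolves.partner {p η : ι → ℂ} {δ₁ δ₂ : ℂ} {A B : ι → ℂ}
    (h : RowSolves p η δ₁ δ₂ A B) :
    RowSolves p η (-conj δ₂) (conj δ₁) (-(conj ∘ B)) (conj ∘ A) where
  left k := by
    have := conj_cauchy δ₁ p A (conj (p k))
    rw [Complex.conj_conj] at this
    rw [← this, Pi.neg_apply, Function.comp_apply, h.right k]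
    simp
  right k := by
    have := conj_cauchy δ₂ (conj ∘ p) B (p k)
    have e : (conj ∘ conj ∘ p : ι → ℂ) = p := by ext; simp
    rw [e] at this
    have e2 : cauchy (-conj δ₂) p (-(conj ∘ B)) (conj (p k)) =
        -cauchy (conj δ₂) p (conj ∘ B) (conj (p k)) := by
      simp [cauchy, neg_div, add_comm]
    rw [e2, ← this, Function.comp_apply, h.left k]
    simp

theorem RowSolves.eq_zero {p η : ι → ℂ} (hp : Separated p) {A B : ι → ℂ}
    (h : RowSolves p η 0 0 A B) : A = 0 ∧ B = 0 := by
  have key : ∀ s : ℝ, cauchy 0 p A s = 0 ∧ cauchy 0 (conj ∘ p) B s = 0 := by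
    intro s
    have hs : ∀ k, (s : ℂ) ≠ p k := fun k h0 =>
      hp.ne_conj k k (by rw [← h0, Complex.conj_ofReal])
    have hs' : ∀ k, (s : ℂ) ≠ conj (p k) := fun k h0 => hs k (by
      rw [← Complex.conj_conj (p k), ← h0, Complex.conj_ofReal])
    -- Both rows have the same coefficients and zero constants, so the right side vanishes, while on
    -- the real line the left side is a sum of two squared moduli.
    have hw := h.wronskian hp h.partner hs hs'
    have e1 := conj_cauchy 0 p A s
    have e2 := conj_cauchy 0 (conj ∘ p) B s
    have e : (conj ∘ conj ∘ p : ι → ℂ) = p := by ext; simp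
    rw [e] at e2
    simp only [map_zero, Complex.conj_ofReal] at e1 e2
    have e3 : cauchy (-conj 0) p (-(conj ∘ B)) (s : ℂ) = -cauchy 0 p (conj ∘ B) (s : ℂ) := by
      simp [cauchy, neg_div]
    rw [e3, map_zero, ← e1, ← e2] at hw
    simp only [sub_self, zero_mul, zero_div, map_zero, add_zero, mul_zero, Finset.sum_const_zero,
      mul_neg, sub_neg_eq_add, Complex.mul_conj] at hw
    norm_cast at hw
    have n1 := Complex.normSq_nonneg (cauchy 0 p A s)
    have n2 := Complex.normSq_nonneg (cauchy 0 (conj ∘ p) B s)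
    exact ⟨Complex.normSq_eq_zero.1 (by linarith), Complex.normSq_eq_zero.1 (by linarith)⟩
  exact ⟨eq_zero_of_cauchy_ofReal hp fun s => (key s).1,
    eq_zero_of_cauchy_ofReal hp.conj fun s => (key s).2⟩

/-- The linear operator of the row system. -/
def rowOp (p η : ι → ℂ) : ((ι → ℂ) × (ι → ℂ)) →ₗ[ℂ] ((ι → ℂ) × (ι → ℂ)) where
  toFun V := (fun k => V.1 k - η k * cauchy 0 (conj ∘ p) V.2 (p k),
    fun k => V.2 k + conj (η k) * cauchy 0 p V.1 (conj (p k)))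
  map_add' V W := by
    ext k <;> simp [cauchy, add_div, Finset.sum_add_distrib] <;> ring
  map_smul' a V := by
    ext k <;> simp [cauchy, mul_div_assoc, ← Finset.mul_sum] <;> ring

theorem rowSolves_iff {p η : ι → ℂ} {δ₁ δ₂ : ℂ} {A B : ι → ℂ} : RowSolves p η δ₁ δ₂ A B ↔
    rowOp p η (A, B) = (fun k => η k * δ₂, fun k => -(conj (η k) * δ₁)) := by
  have e : ∀ (δ : ℂ) (p A : ι → ℂ) w, cauchy δ p A w = δ + cauchy 0 p A w := by
    simp [cauchy]
  constructor
  · intro h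
    refine Prod.ext (funext fun k => ?_) (funext fun k => ?_)
    · have := h.left k
      rw [e] at this
      simp only [rowOp, LinearMap.coe_mk, AddHom.coe_mk]
      linear_combination this
    · have := h.right k
      rw [e] at this
      simp only [rowOp, LinearMap.coe_mk, AddHom.coe_mk]
      linear_combination this
  · intro h
    constructor
    · intro k
      have := congrFun (congrArg Prod.fst h) k
      simp only [rowOp, LinearMap.coe_mk, AddHom.coe_mk] at this
      rw [e]
      linear_combination this
    · intro k
      have := congrFun (congrArg Prod.snd h) k
      simp only [rowOp, LinearMap.coe_mk, AddHom.coe_mk] at this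
      rw [e]
      linear_combination this

theorem rowOp_injective {p : ι → ℂ} (hp : Separated p) (η : ι → ℂ) :
    Function.Injective (rowOp p η) := by
  rw [← LinearMap.ker_eq_bot, LinearMap.ker_eq_bot']
  intro V hV
  have h : RowSolves p η 0 0 V.1 V.2 := rowSolves_iff.2 (by rw [Prod.mk.eta, hV]; ext <;> simp)
  exact Prod.ext (h.eq_zero hp).1 (h.eq_zero hp).2

theorem exists_rowSolves {p : ι → ℂ} (hp : Separated p) (η : ι → ℂ) (δ₁ δ₂ : ℂ) :
    ∃ A B, RowSolves p η δ₁ δ₂ A B := by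
  obtain ⟨V, hV⟩ := LinearMap.injective_iff_surjective.1 (rowOp_injective hp η)
    (fun k => η k * δ₂, fun k => -(conj (η k) * δ₁))
  exact ⟨V.1, V.2, rowSolves_iff.2 hV⟩

/-- The operator is injective for every `η` and jointly continuous in `η` and `V`, so its norm has a
positive minimum over bounded `η` and unit vectors; homogeneity does the rest. -/
theorem exists_rowOp_lower_bound {p : ι → ℂ} (hp : Separated p) (R : ℝ) :
    ∃ m > 0, ∀ η : ι → ℂ, ‖η‖ ≤ R → ∀ V, m * ‖V‖ ≤ ‖rowOp p η V‖ := by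
  have hK : IsCompact (Metric.closedBall (0 : ι → ℂ) R ×ˢ
      Metric.sphere (0 : (ι → ℂ) × (ι → ℂ)) 1) :=
    (isCompact_closedBall _ _).prod (isCompact_sphere _ _)
  have hcont : Continuous fun x : (ι → ℂ) × ((ι → ℂ) × (ι → ℂ)) => ‖rowOp p x.1 x.2‖ := by
    refine Continuous.norm ?_
    simp only [rowOp, LinearMap.coe_mk, AddHom.coe_mk, cauchy]
    refine Continuous.prodMk ?_ ?_ <;> refine continuous_pi fun k => ?_
    · simp only [div_eq_mul_inv]
      fun_prop
    · simp only [div_eq_mul_inv]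
      have := Complex.continuous_conj
      fun_prop
  -- This form of the minimum principle also covers an empty compact set (negative `R` or no poles).
  obtain ⟨m, hm, h⟩ := hK.exists_forall_le' hcont.continuousOn (a := 0) (by
    rintro ⟨η, V⟩ ⟨-, hV⟩
    refine norm_pos_iff.2 fun h0 => ?_
    have : V = 0 := rowOp_injective hp η (by simpa using h0)
    simp [this] at hV)
  refine ⟨m, hm, fun η hη V => ?_⟩
  by_cases hV : V = 0
  · simp [hV]
  have hV' : 0 < ‖V‖ := norm_pos_iff.2 hV
  have := h (η, ((‖V‖⁻¹ : ℝ) : ℂ) • V) ⟨by simpa using hη, by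
    simp [norm_smul, hV'.ne']⟩
  simp only [map_smul, norm_smul, Complex.norm_real, norm_inv, norm_norm] at this
  rwa [le_inv_mul_iff₀ hV', mul_comm] at this

theorem exists_rowSolves_bound {p : ι → ℂ} (hp : Separated p) (R : ℝ) :
    ∃ C ≥ 0, ∀ η : ι → ℂ, ‖η‖ ≤ R → ∀ δ₁ δ₂ : ℂ, ‖δ₁‖ ≤ 1 → ‖δ₂‖ ≤ 1 → ∀ A B,
      RowSolves p η δ₁ δ₂ A B → ∀ k, ‖A k‖ ≤ C ∧ ‖B k‖ ≤ C := by
  obtain ⟨m, hm, h⟩ := exists_rowOp_lower_bound hp R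
  -- The right side of the row system has norm at most `|R|`; the absolute value keeps the constant
  -- nonnegative for every `R`.
  refine ⟨|R| / m, by positivity, fun η hη δ₁ δ₂ h1 h2 A B hAB k => ?_⟩
  have hη' : ∀ k, ‖η k‖ ≤ |R| := fun k => (norm_le_pi_norm η k).trans (hη.trans (le_abs_self R))
  have h3 : ‖rowOp p η (A, B)‖ ≤ |R| := by
    rw [rowSolves_iff.1 hAB, Prod.norm_mk]
    refine max_le ((pi_norm_le_iff_of_nonneg (abs_nonneg R)).2 fun k => ?_)
      ((pi_norm_le_iff_of_nonneg (abs_nonneg R)).2 fun k => ?_)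
    · rw [norm_mul]
      simpa using mul_le_mul (hη' k) h2 (norm_nonneg _) (abs_nonneg R)
    · rw [norm_neg, norm_mul, RCLike.norm_conj]
      simpa using mul_le_mul (hη' k) h1 (norm_nonneg _) (abs_nonneg R)
  have h4 : ‖(A, B)‖ ≤ |R| / m := by
    rw [le_div_iff₀ hm, mul_comm]
    exact (h η hη _).trans h3
  exact ⟨(norm_le_pi_norm A k).trans ((norm_fst_le (A, B)).trans h4),
    (norm_le_pi_norm B k).trans ((norm_snd_le (A, B)).trans h4)⟩

end RowSystem

/-! ### Residue conditions read entrywise -/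

theorem hasResidueCondition_iff {M : ℂ → Matrix (Fin 2) (Fin 2) ℂ} {u : ℂ}
    {A : Matrix (Fin 2) (Fin 2) ℂ} : HasResidueCondition M u A ↔ ∀ i j, ∃ R,
      Tendsto (fun w => (w - u) * M w i j) (𝓝[≠] u) (𝓝 R) ∧
      Tendsto (fun w => M w i 0 * A 0 j + M w i 1 * A 1 j) (𝓝[≠] u) (𝓝 R) := by
  constructor
  · rintro ⟨R, h1, h2⟩ i j
    refine ⟨R i j, (tendsto_pi_nhds.1 (tendsto_pi_nhds.1 h1 i) j), ?_⟩
    simpa [Matrix.mul_apply, Fin.sum_univ_two] using (tendsto_pi_nhds.1 (tendsto_pi_nhds.1 h2 i) j)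
  · intro h
    choose R h1 h2 using h
    refine ⟨Matrix.of R, tendsto_pi_nhds.2 fun i => tendsto_pi_nhds.2 fun j => h1 i j,
      tendsto_pi_nhds.2 fun i => tendsto_pi_nhds.2 fun j => ?_⟩
    simpa [Matrix.mul_apply, Fin.sum_univ_two] using h2 i j

/-- At a lower triangular residue condition the second column has no pole. -/
theorem hasResidueCondition_lower_iff {M : ℂ → Matrix (Fin 2) (Fin 2) ℂ} {u η : ℂ} :
    HasResidueCondition M u !![0, 0; η, 0] ↔ ∀ i,
      (∃ R, Tendsto (fun w => (w - u) * M w i 0) (𝓝[≠] u) (𝓝 R) ∧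
        Tendsto (fun w => η * M w i 1) (𝓝[≠] u) (𝓝 R)) ∧
      Tendsto (fun w => (w - u) * M w i 1) (𝓝[≠] u) (𝓝 0) := by
  rw [hasResidueCondition_iff]
  refine forall_congr' fun i => ?_
  rw [Fin.forall_fin_two]
  refine and_congr ?_ ?_
  · simp [mul_comm η]
  · simp only [Matrix.of_apply, Matrix.cons_val', Matrix.cons_val_zero, Matrix.cons_val_one,
      Matrix.cons_val_fin_one, mul_zero, add_zero]
    constructor
    · rintro ⟨R, h1, h2⟩
      rwa [tendsto_nhds_unique h2 tendsto_const_nhds] at h1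
    · exact fun h => ⟨0, h, tendsto_const_nhds⟩

/-- At an upper triangular residue condition the first column has no pole. -/
theorem hasResidueCondition_upper_iff {M : ℂ → Matrix (Fin 2) (Fin 2) ℂ} {u η : ℂ} :
    HasResidueCondition M u !![0, η; 0, 0] ↔ ∀ i,
      (∃ R, Tendsto (fun w => (w - u) * M w i 1) (𝓝[≠] u) (𝓝 R) ∧
        Tendsto (fun w => η * M w i 0) (𝓝[≠] u) (𝓝 R)) ∧
      Tendsto (fun w => (w - u) * M w i 0) (𝓝[≠] u) (𝓝 0) := by
  rw [hasResidueCondition_iff]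
  refine forall_congr' fun i => ?_
  rw [Fin.forall_fin_two, and_comm]
  refine and_congr ?_ ?_
  · simp [mul_comm η]
  · simp only [Matrix.of_apply, Matrix.cons_val', Matrix.cons_val_zero, Matrix.cons_val_one,
      Matrix.cons_val_fin_one, mul_zero, add_zero]
    constructor
    · rintro ⟨R, h1, h2⟩
      rwa [tendsto_nhds_unique h2 tendsto_const_nhds] at h1
    · exact fun h => ⟨0, h, tendsto_const_nhds⟩

/-! ### Solutions of the pole problem and their comparison -/

section Poles

variable {N : ℕ}

theorem poleSet_finite (p : Fin N → ℂ) (K : Finset (Fin N)) : (poleSet p K).Finite := by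
  refine ((K.image p ∪ K.image (conj ∘ p)).finite_toSet).subset ?_
  rintro w ⟨k, hk, rfl | rfl⟩
  · simpa using Or.inl ⟨k, hk, rfl⟩
  · simpa using Or.inr ⟨k, hk, rfl⟩

theorem differentiableOn_cauchy (δ : ℂ) {p A : Fin N → ℂ} {K : Finset (Fin N)}
    (hA : ∀ k ∉ K, A k = 0) :
    DifferentiableOn ℂ (cauchy δ p A) (poleSet p K)ᶜ := fun w hw => by
  refine (differentiableAt_cauchy δ fun k => ?_).differentiableWithinAt
  by_cases hk : k ∈ K
  · exact Or.inr fun h => hw ⟨k, hk, Or.inl h⟩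
  · exact Or.inl (hA k hk)

theorem poleSet_conj (p : Fin N → ℂ) (K : Finset (Fin N)) :
    poleSet (conj ∘ p) K = poleSet p K := by
  ext w
  simp [poleSet, or_comm]

/-- A function that is analytic off finitely many simple poles, of which those at the `p_k^*` are
removable, is the sum of its principal parts. -/
theorem eq_cauchy {p : Fin N → ℂ} (hp : Separated p) {K : Finset (Fin N)} {δ : ℂ} {A : Fin N → ℂ}
    (hA : ∀ k ∉ K, A k = 0) {f : ℂ → ℂ} (hf : DifferentiableOn ℂ f (poleSet p K)ᶜ)
    (hδ : Tendsto (fun w => f w - δ) (Bornology.cobounded ℂ) (𝓝 0))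
    (h1 : ∀ k ∈ K, Tendsto (fun w => (w - p k) * f w) (𝓝[≠] (p k)) (𝓝 (A k)))
    (h2 : ∀ k ∈ K, Tendsto (fun w => (w - conj (p k)) * f w) (𝓝[≠] (conj (p k))) (𝓝 0))
    {w : ℂ} (hw : w ∉ poleSet p K) : f w = cauchy δ p A w := by
  have hfin := poleSet_finite p K
  have := eq_zero_of_removable hfin.toFinset (fun w => f w - cauchy δ p A w)
    (by rw [hfin.coe_toFinset]; exact hf.sub (differentiableOn_cauchy δ hA)) ?_ ?_ w (by simpa using hw)
  · exact sub_eq_zero.1 this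
  · intro u hu
    obtain ⟨k, hk, rfl | rfl⟩ := hfin.mem_toFinset.1 hu
    · simpa [mul_sub] using (h1 k hk).sub (tendsto_sub_mul_cauchy δ hp.injective A k)
    · simpa [mul_sub] using (h2 k hk).sub
        (tendsto_sub_mul_cauchy_of_ne δ A fun j h => hp.ne_conj j k h.symm)
  · simpa using hδ.sub (cauchy_tendsto δ p A)

theorem poleSet_compl_mem {p : Fin N → ℂ} (K : Finset (Fin N)) (u : ℂ) :
    (poleSet p K)ᶜ ∈ 𝓝[≠] u := by
  have h : (poleSet p K \ {u})ᶜ ∈ 𝓝 u :=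
    ((poleSet_finite p K).subset Set.sdiff_subset).isClosed.isOpen_compl.mem_nhds (by simp)
  filter_upwards [mem_nhdsWithin_of_mem_nhds h, self_mem_nhdsWithin] with w h1 h2 h3
  exact h1 ⟨h3, h2⟩

/-- The abstract form of the pole problem: `p` are the poles of the first column. -/
structure SolvesPoles (p η : Fin N → ℂ) (K : Finset (Fin N)) (M : ℂ → Matrix (Fin 2) (Fin 2) ℂ) :
    Prop where
  analytic : ∀ i j, DifferentiableOn ℂ (fun w => M w i j) (poleSet p K)ᶜ
  normalized : ∀ i j, (fun w => M w i j - (1 : Matrix (Fin 2) (Fin 2) ℂ) i j)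
    =O[Bornology.cobounded ℂ] (fun w : ℂ => w⁻¹)
  lower : ∀ k ∈ K, HasResidueCondition M (p k) !![0, 0; η k, 0]
  upper : ∀ k ∈ K, HasResidueCondition M (conj (p k)) !![0, -conj (η k); 0, 0]

/-- By the Liouville argument of `eq_cauchy` each entry is the sum of its principal parts. The
residue conditions then become the row equations, since each column is continuous at the poles of
the other. -/
theorem SolvesPoles.exists_rowSolves {p η : Fin N → ℂ} (hp : Separated p) {K : Finset (Fin N)}
    (hη : ∀ k ∉ K, η k = 0) {M : ℂ → Matrix (Fin 2) (Fin 2) ℂ} (h : SolvesPoles p η K M)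
    (i : Fin 2) : ∃ A B : Fin N → ℂ,
      RowSolves p η ((1 : Matrix (Fin 2) (Fin 2) ℂ) i 0) ((1 : Matrix (Fin 2) (Fin 2) ℂ) i 1) A B ∧
      ∀ w ∉ poleSet p K, M w i 0 = cauchy ((1 : Matrix (Fin 2) (Fin 2) ℂ) i 0) p A w ∧
        M w i 1 = cauchy ((1 : Matrix (Fin 2) (Fin 2) ℂ) i 1) (conj ∘ p) B w := by
  classical
  have hl := fun k hk => hasResidueCondition_lower_iff.1 (h.lower k hk) i
  have hu := fun k hk => hasResidueCondition_upper_iff.1 (h.upper k hk) i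
  choose! A hA using fun k hk => (hl k hk).1
  choose! B hB using fun k hk => (hu k hk).1
  -- Residues are extended by zero off `K`. As `η` vanishes there too, systems with different `K`
  -- live on the same index set and can be compared.
  have hAK : ∀ k ∈ K, (fun k => if k ∈ K then A k else 0) k = A k := fun k hk => if_pos hk
  have hBK : ∀ k ∈ K, (fun k => if k ∈ K then B k else 0) k = B k := fun k hk => if_pos hk
  have hA0 : ∀ k ∉ K, (fun k => if k ∈ K then A k else 0) k = 0 := fun k hk => if_neg hk
  have hB0 : ∀ k ∉ K, (fun k => if k ∈ K then B k else 0) k = 0 := fun k hk => if_neg hk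
  generalize (fun k => if k ∈ K then A k else 0) = A' at hAK hA0
  generalize (fun k => if k ∈ K then B k else 0) = B' at hBK hB0
  have ha : ∀ w ∉ poleSet p K, M w i 0 = cauchy ((1 : Matrix (Fin 2) (Fin 2) ℂ) i 0) p A' w :=
    fun w hw => eq_cauchy hp hA0 (h.analytic i 0)
      ((h.normalized i 0).trans_tendsto tendsto_inv₀_cobounded)
      (fun k hk => by rw [hAK k hk]; exact (hA k hk).1) (fun k hk => (hu k hk).2) hw
  have hb : ∀ w ∉ poleSet p K,
      M w i 1 = cauchy ((1 : Matrix (Fin 2) (Fin 2) ℂ) i 1) (conj ∘ p) B' w :=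
    fun w hw => eq_cauchy hp.conj hB0 (by rw [poleSet_conj]; exact h.analytic i 1)
      ((h.normalized i 1).trans_tendsto tendsto_inv₀_cobounded)
      (fun k hk => by rw [hBK k hk]; exact (hB k hk).1)
      (fun k hk => by simpa using (hl k hk).2) (by rwa [poleSet_conj])
  refine ⟨A', B', ⟨fun k => ?_, fun k => ?_⟩, fun w hw => ⟨ha w hw, hb w hw⟩⟩
  · by_cases hk : k ∈ K
    · have hc : ContinuousAt (cauchy ((1 : Matrix (Fin 2) (Fin 2) ℂ) i 1) (conj ∘ p) B') (p k) :=
        (differentiableAt_cauchy _ fun j => Or.inr (hp.ne_conj k j)).continuousAt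
      have h1 := (hc.tendsto.mono_left (nhdsWithin_le_nhds (s := {p k}ᶜ))).const_mul (η k)
      rw [hAK k hk]
      refine tendsto_nhds_unique ((hA k hk).2.congr' ?_) h1
      filter_upwards [poleSet_compl_mem K (p k)] with w hw
      rw [hb w hw]
    · rw [hA0 k hk, hη k hk, zero_mul]
  · by_cases hk : k ∈ K
    · have hc : ContinuousAt (cauchy ((1 : Matrix (Fin 2) (Fin 2) ℂ) i 0) p A') (conj (p k)) :=
        (differentiableAt_cauchy _ fun j => Or.inr (hp.ne_conj j k).symm).continuousAt
      have h1 := (hc.tendsto.mono_left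
        (nhdsWithin_le_nhds (s := {conj (p k)}ᶜ))).const_mul (-conj (η k))
      rw [hBK k hk]
      refine tendsto_nhds_unique ((hB k hk).2.congr' ?_) h1
      filter_upwards [poleSet_compl_mem K (conj (p k))] with w hw
      rw [ha w hw]
    · rw [hB0 k hk, hη k hk, map_zero, neg_zero, zero_mul]

theorem exists_solvesPoles {p η : Fin N → ℂ} (hp : Separated p) {K : Finset (Fin N)}
    (hη : ∀ k ∉ K, η k = 0) : ∃ M, SolvesPoles p η K M := by
  choose A B h using fun i : Fin 2 => CGNLS.exists_rowSolves hp η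
    ((1 : Matrix (Fin 2) (Fin 2) ℂ) i 0) ((1 : Matrix (Fin 2) (Fin 2) ℂ) i 1)
  have hA : ∀ i, ∀ k ∉ K, A i k = 0 := fun i k hk => by rw [(h i).left, hη k hk, zero_mul]
  have hB : ∀ i, ∀ k ∉ K, B i k = 0 := fun i k hk => by rw [(h i).right, hη k hk]; simp
  refine ⟨fun w => Matrix.of fun i =>
    ![cauchy ((1 : Matrix (Fin 2) (Fin 2) ℂ) i 0) p (A i) w,
      cauchy ((1 : Matrix (Fin 2) (Fin 2) ℂ) i 1) (conj ∘ p) (B i) w], ?_, ?_, ?_, ?_⟩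
  · intro i j
    fin_cases j
    · exact differentiableOn_cauchy _ (hA i)
    · exact poleSet_conj p K ▸ differentiableOn_cauchy _ (hB i)
  · intro i j
    fin_cases j
    · exact cauchy_sub_isBigO _ p (A i)
    · exact cauchy_sub_isBigO _ (conj ∘ p) (B i)
  · intro k _
    refine hasResidueCondition_lower_iff.2 fun i =>
      ⟨⟨A i k, tendsto_sub_mul_cauchy _ hp.injective _ _, ?_⟩,
        tendsto_sub_mul_cauchy_of_ne _ _ fun j => hp.ne_conj k j⟩
    have hc : ContinuousAt (cauchy ((1 : Matrix (Fin 2) (Fin 2) ℂ) i 1) (conj ∘ p) (B i)) (p k) :=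
      (differentiableAt_cauchy _ fun j => Or.inr (hp.ne_conj k j)).continuousAt
    rw [(h i).left]
    exact (hc.tendsto.mono_left nhdsWithin_le_nhds).const_mul (η k)
  · intro k _
    refine hasResidueCondition_upper_iff.2 fun i =>
      ⟨⟨B i k, tendsto_sub_mul_cauchy _ hp.conj.injective _ k, ?_⟩,
        tendsto_sub_mul_cauchy_of_ne _ _ fun j => (hp.ne_conj j k).symm⟩
    have hc : ContinuousAt (cauchy ((1 : Matrix (Fin 2) (Fin 2) ℂ) i 0) p (A i)) (conj (p k)) :=
      (differentiableAt_cauchy _ fun j => Or.inr (hp.ne_conj j k).symm).continuousAt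
    rw [(h i).right]
    exact (hc.tendsto.mono_left nhdsWithin_le_nhds).const_mul (-conj (η k))

/-- The correction term of the Wronskian of two rows is small if the coefficients with index in
`K` agree and the other ones are small. -/
theorem exists_wronskian_bound {p : Fin N → ℂ} (hp : Separated p) (K : Finset (Fin N)) (R : ℝ)
    {r : ℝ} (hr : 0 < r) : ∃ C : ℝ, ∀ η η' : Fin N → ℂ, ‖η‖ ≤ R → ‖η'‖ ≤ R →
      ∀ ε, 0 ≤ ε → (∀ k ∈ K, η k = η' k) → (∀ k ∉ K, ‖η k - η' k‖ ≤ ε) →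
      ∀ δ₁ δ₂ δ₁' δ₂' : ℂ, ‖δ₁‖ ≤ 1 → ‖δ₂‖ ≤ 1 → ‖δ₁'‖ ≤ 1 → ‖δ₂'‖ ≤ 1 → ∀ A B A' B',
      RowSolves p η δ₁ δ₂ A B → RowSolves p η' δ₁' δ₂' A' B' → ∀ w ∈ awayFrom p K r,
      ‖cauchy δ₁ p A w * cauchy δ₂' (conj ∘ p) B' w
        - cauchy δ₂ (conj ∘ p) B w * cauchy δ₁' p A' w - (δ₁ * δ₂' - δ₂ * δ₁')‖ ≤ C * ε := by
  obtain ⟨C₀, hC₀, hb⟩ := exists_rowSolves_bound hp R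
  -- `Q` bounds each column at the poles of the other one, uniformly in `η`; only these values occur
  -- in the Wronskian.
  set Q : ℝ := 1 + C₀ * ∑ k, ∑ j, ‖p k - conj (p j)‖⁻¹ with hQ
  have hQ0 : 0 ≤ Q := by positivity
  have hsum : ∀ k, 1 + C₀ * ∑ j, ‖p k - conj (p j)‖⁻¹ ≤ Q := fun k => by
    have := Finset.single_le_sum (f := fun k => ∑ j, ‖p k - conj (p j)‖⁻¹)
      (fun k _ => by positivity) (Finset.mem_univ k)
    rw [hQ]
    gcongr
  have hnorm : ∀ k j, ‖conj (p k) - p j‖ = ‖p k - conj (p j)‖ := fun k j => by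
    rw [← RCLike.norm_conj]
    simp
  have hq : ∀ η, ‖η‖ ≤ R → ∀ δ₁ δ₂ : ℂ, ‖δ₁‖ ≤ 1 → ‖δ₂‖ ≤ 1 → ∀ A B, RowSolves p η δ₁ δ₂ A B →
      ∀ k, ‖cauchy δ₁ p A (conj (p k))‖ ≤ Q ∧ ‖cauchy δ₂ (conj ∘ p) B (p k)‖ ≤ Q := by
    intro η hη δ₁ δ₂ h1 h2 A B h k
    have h3 := hb η hη δ₁ δ₂ h1 h2 A B h
    refine ⟨(norm_cauchy_le p _ h1 fun k => (h3 k).1).trans ?_,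
      (norm_cauchy_le _ _ h2 fun k => (h3 k).2).trans (hsum k)⟩
    simp only [hnorm]
    exact hsum k
  refine ⟨∑ _k : Fin N, (2 * Q ^ 2 / r), ?_⟩
  intro η η' hη hη' ε hε hK hKc δ₁ δ₂ δ₁' δ₂' h1 h2 h1' h2' A B A' B' h h' w hw
  have hwp : ∀ k, w ≠ p k := fun k hk => by
    by_cases hkK : k ∈ K
    · exact hw.1 ⟨k, hkK, Or.inl hk⟩
    · have := hw.2 (p k) ⟨k, by simpa using hkK, Or.inl rfl⟩
      rw [hk, sub_self, norm_zero] at this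
      exact this.not_gt hr
  have hwq : ∀ k, w ≠ conj (p k) := fun k hk => by
    by_cases hkK : k ∈ K
    · exact hw.1 ⟨k, hkK, Or.inr hk⟩
    · have := hw.2 (conj (p k)) ⟨k, by simpa using hkK, Or.inr rfl⟩
      rw [hk, sub_self, norm_zero] at this
      exact this.not_gt hr
  rw [h.wronskian hp h' hwp hwq, add_sub_cancel_left, Finset.sum_mul]
  refine (norm_sum_le _ _).trans (Finset.sum_le_sum fun k _ => ?_)
  by_cases hk : k ∈ K
  · rw [hK k hk]
    simpa using by positivity
  · have hd1 := hw.2 (p k) ⟨k, by simpa using hk, Or.inl rfl⟩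
    have hd2 := hw.2 (conj (p k)) ⟨k, by simpa using hk, Or.inr rfl⟩
    have q1 := hq η hη δ₁ δ₂ h1 h2 A B h k
    have q2 := hq η' hη' δ₁' δ₂' h1' h2' A' B' h' k
    have e := hKc k hk
    have e' : ∀ x u v d : ℂ, ‖x‖ ≤ ε → ‖u‖ ≤ Q → ‖v‖ ≤ Q → r ≤ ‖d‖ →
        ‖x * (u * v) / d‖ ≤ ε * (Q * Q) / r := by
      intro x u v d hx hu hv hd
      rw [norm_div, norm_mul, norm_mul]
      gcongr
    refine (norm_add_le _ _).trans ((add_le_add (e' _ _ _ _ e q1.2 q2.2 hd1)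
      (e' _ _ _ _ (by rwa [RCLike.norm_conj]) q1.1 q2.1 hd2)).trans_eq ?_)
    ring

/-- Solutions with bounded residue coefficients, of which those with index outside `K` are at most
`ε`, are close to the solutions of the problem with these coefficients dropped. -/
theorem exists_reduction_bound {p : Fin N → ℂ} (hp : Separated p) (K : Finset (Fin N)) (R : ℝ)
    {r : ℝ} (hr : 0 < r) : ∃ C : ℝ, ∀ η η' : Fin N → ℂ, ‖η‖ ≤ R →
      (∀ k ∈ K, η k = η' k) → (∀ k ∉ K, η' k = 0) → ∀ ε, 0 ≤ ε → (∀ k ∉ K, ‖η k‖ ≤ ε) →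
      ∀ M M', SolvesPoles p η Finset.univ M → SolvesPoles p η' K M' →
      ∀ w ∈ awayFrom p K r, ∃ E : Matrix (Fin 2) (Fin 2) ℂ,
        (∀ i j, ‖E i j‖ ≤ C * ε) ∧ M w = (1 + E) * M' w := by
  obtain ⟨C, hC⟩ := exists_wronskian_bound hp K R hr
  refine ⟨C, fun η η' hη hK hKc ε hε hle M M' hM hM' w hw => ?_⟩
  have hη' : ‖η'‖ ≤ R := (pi_norm_le_iff_of_nonneg ((norm_nonneg η).trans hη)).2 fun k => by
    by_cases hk : k ∈ K
    · rw [← hK k hk]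
      exact (norm_le_pi_norm η k).trans hη
    · rw [hKc k hk, norm_zero]
      exact (norm_nonneg η).trans hη
  have hwu : w ∉ poleSet p Finset.univ := by
    rintro ⟨k, -, hk⟩
    by_cases hkK : k ∈ K
    · exact hw.1 ⟨k, hkK, hk⟩
    · have := hw.2 w ⟨k, by simpa using hkK, hk⟩
      rw [sub_self, norm_zero] at this
      exact this.not_gt hr
  obtain ⟨A₀, B₀, h0, e0⟩ := hM.exists_rowSolves hp (by simp) 0
  obtain ⟨A₁, B₁, h1, e1⟩ := hM.exists_rowSolves hp (by simp) 1
  obtain ⟨A₀', B₀', h0', e0'⟩ := hM'.exists_rowSolves hp hKc 0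
  obtain ⟨A₁', B₁', h1', e1'⟩ := hM'.exists_rowSolves hp hKc 1
  have hd : ∀ k ∉ K, ‖η k - η' k‖ ≤ ε := fun k hk => by
    rw [hKc k hk, sub_zero]
    exact hle k hk
  have n1 : ∀ i j, ‖(1 : Matrix (Fin 2) (Fin 2) ℂ) i j‖ ≤ 1 := fun i j => by
    rw [Matrix.one_apply]
    split_ifs <;> simp
  have w00 := hC η η' hη hη' ε hε hK hd _ _ _ _ (n1 _ _) (n1 _ _) (n1 _ _) (n1 _ _) _ _ _ _
    h0 h0' w hw
  have w01 := hC η η' hη hη' ε hε hK hd _ _ _ _ (n1 _ _) (n1 _ _) (n1 _ _) (n1 _ _) _ _ _ _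
    h0 h1' w hw
  have w10 := hC η η' hη hη' ε hε hK hd _ _ _ _ (n1 _ _) (n1 _ _) (n1 _ _) (n1 _ _) _ _ _ _
    h1 h0' w hw
  have w11 := hC η η' hη hη' ε hε hK hd _ _ _ _ (n1 _ _) (n1 _ _) (n1 _ _) (n1 _ _) _ _ _ _
    h1 h1' w hw
  -- Equal coefficients allow `ε = 0`: the Wronskian of the two rows of `M'` is exactly its
  -- constant, so `det M' = 1`.
  have hdet := hC η' η' hη' hη' 0 le_rfl (fun _ _ => rfl) (fun _ _ => by simp) _ _ _ _
    (n1 _ _) (n1 _ _) (n1 _ _) (n1 _ _) _ _ _ _ h0' h1' w hw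
  rw [mul_zero, norm_le_zero_iff] at hdet
  rw [← (e0 w hwu).1, ← (e0 w hwu).2] at w00 w01
  rw [← (e1 w hwu).1, ← (e1 w hwu).2] at w10 w11
  rw [← (e0' w hw.1).1, ← (e0' w hw.1).2] at w00 w10 hdet
  rw [← (e1' w hw.1).1, ← (e1' w hw.1).2] at w01 w11 hdet
  simp only [Matrix.one_apply_eq, Matrix.one_apply_ne zero_ne_one,
    Matrix.one_apply_ne one_ne_zero] at w00 w01 w10 w11 hdet
  refine ⟨!![M w 0 0 * M' w 1 1 - M w 0 1 * M' w 1 0 - 1,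
    -(M w 0 0 * M' w 0 1 - M w 0 1 * M' w 0 0);
    M w 1 0 * M' w 1 1 - M w 1 1 * M' w 1 0,
    -(M w 1 0 * M' w 0 1 - M w 1 1 * M' w 0 0) - 1], ?_, ?_⟩
  · intro i j
    fin_cases i <;> fin_cases j
    · simpa using w01
    · simpa [norm_sub_rev] using w00
    · simpa using w11
    · refine le_of_eq_of_le ?_ w10
      rw [← norm_neg]
      congr 1
      simp
      ring
  · ext i j
    fin_cases i <;> fin_cases j <;> simp [Matrix.mul_apply, Fin.sum_univ_two]
    · linear_combination (-M w 0 0) * hdet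
    · linear_combination (-M w 0 1) * hdet
    · linear_combination (-M w 1 0) * hdet
    · linear_combination (-M w 1 1) * hdet

end Poles

/-! ### From the normalized problem to the abstract one -/

section Reduction

variable {N : ℕ}

open scoped Classical in
/-- The pole of the first column among `z_k, z_k^*`. -/
def firstPole (z : Fin N → ℂ) (D : Finset (Fin N)) (k : Fin N) : ℂ :=
  if k ∈ D then conj (z k) else z k

open scoped Classical in
/-- The residue coefficient at the pole of the first column, for the poles indexed by `K`. -/
def firstCoeff (α γ x t : ℝ) (z c : Fin N → ℂ) (K D : Finset (Fin N)) (k : Fin N) : ℂ :=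
  if k ∈ K then
    if k ∈ D then -conj (residueCoeff α γ x t z c (D ∩ K) k)
    else residueCoeff α γ x t z c (D ∩ K) k
  else 0

/-- The points `z k` and `conj (z k)` are all distinct, and each index selects one member of its own
pair. -/
theorem separated_firstPole {z : Fin N → ℂ} (hz : Function.Injective z) (hIm : ∀ k, 0 < (z k).im)
    (D : Finset (Fin N)) : Separated (firstPole z D) := by
  have hne : ∀ j k, z j ≠ conj (z k) := fun j k h => by
    have := congrArg Complex.im h
    rw [Complex.conj_im] at this
    linarith [hIm j, hIm k]
  constructor
  · intro j k h
    simp only [firstPole] at h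
    split_ifs at h
    · exact hz ((starRingEnd ℂ).injective h)
    · exact absurd h.symm (hne _ _)
    · exact absurd h (hne _ _)
    · exact hz h
  · intro j k h
    simp only [firstPole] at h
    split_ifs at h with h1 h2 h2
    · rw [Complex.conj_conj] at h
      exact hne _ _ h.symm
    · exact h2 (hz ((starRingEnd ℂ).injective h) ▸ h1)
    · rw [Complex.conj_conj] at h
      exact h1 (hz h ▸ h2)
    · exact hne _ _ h

theorem poleSet_firstPole (z : Fin N → ℂ) (D K : Finset (Fin N)) :
    poleSet (firstPole z D) K = poleSet z K := by
  ext w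
  simp only [poleSet, Set.mem_ofPred_eq]
  refine exists_congr fun k => and_congr_right fun _ => ?_
  rw [firstPole]
  split_ifs
  · rw [Complex.conj_conj, or_comm]
  · rfl

theorem awayFrom_firstPole (z : Fin N → ℂ) (D K : Finset (Fin N)) (r : ℝ) :
    awayFrom (firstPole z D) K r = awayFrom z K r := by
  simp only [awayFrom, poleSet_firstPole]

theorem sigma2_conj_upper (n : ℂ) : sigma2 * (!![0, n; 0, 0] : Matrix _ _ ℂ).map conj * sigma2 =
    !![0, 0; -conj n, 0] := by
  have h : (!![0, n; 0, 0] : Matrix (Fin 2) (Fin 2) ℂ).map conj = !![0, conj n; 0, 0] := by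
    ext i j
    fin_cases i <;> fin_cases j <;> simp
  rw [h]
  ext i j
  fin_cases i <;> fin_cases j <;> simp [sigma2, Matrix.mul_apply, Fin.sum_univ_two]
  linear_combination conj n * Complex.I_mul_I

theorem sigma2_conj_lower (n : ℂ) : sigma2 * (!![0, 0; n, 0] : Matrix _ _ ℂ).map conj * sigma2 =
    !![0, -conj n; 0, 0] := by
  have h : (!![0, 0; n, 0] : Matrix (Fin 2) (Fin 2) ℂ).map conj = !![0, 0; conj n, 0] := by
    ext i j
    fin_cases i <;> fin_cases j <;> simp
  rw [h]
  ext i j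
  fin_cases i <;> fin_cases j <;> simp [sigma2, Matrix.mul_apply, Fin.sum_univ_two]
  linear_combination conj n * Complex.I_mul_I

/-- For `k ∈ D` the roles of `z k` and its conjugate are exchanged: the `sigma2` symmetry turns the
upper triangular matrix with entry `n` into a lower triangular one with entry `-conj n`, which is
the coefficient chosen in `firstCoeff`. -/
theorem isSolution_iff (α γ x t : ℝ) (z c : Fin N → ℂ) (K D : Finset (Fin N))
    (M : ℂ → Matrix (Fin 2) (Fin 2) ℂ) : IsSolution α γ x t z c K (D ∩ K) M ↔
      SolvesPoles (firstPole z D) (firstCoeff α γ x t z c K D) K M := by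
  have hu : ∀ k ∈ K, k ∈ D →
      residueMatrix α γ x t z c (D ∩ K) k = !![0, residueCoeff α γ x t z c (D ∩ K) k; 0, 0] :=
    fun k hk hD => if_pos (Finset.mem_inter.2 ⟨hD, hk⟩)
  have hl : ∀ k ∈ K, k ∉ D →
      residueMatrix α γ x t z c (D ∩ K) k = !![0, 0; residueCoeff α γ x t z c (D ∩ K) k, 0] :=
    fun k hk hD => if_neg fun h => hD (Finset.mem_inter.1 h).1
  constructor
  · intro h
    refine ⟨by rw [poleSet_firstPole]; exact h.analytic, h.normalized, fun k hk => ?_,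
      fun k hk => ?_⟩
    · by_cases hD : k ∈ D
      · have := h.residue_conj k hk
        rw [hu k hk hD, sigma2_conj_upper] at this
        simpa only [firstPole, firstCoeff, if_pos hk, if_pos hD] using this
      · have := h.residue k hk
        rw [hl k hk hD] at this
        simpa only [firstPole, firstCoeff, if_pos hk, if_neg hD] using this
    · by_cases hD : k ∈ D
      · have := h.residue k hk
        rw [hu k hk hD] at this
        simpa only [firstPole, firstCoeff, if_pos hk, if_pos hD, Complex.conj_conj, map_neg,
          neg_neg] using this
      · have := h.residue_conj k hk
        rw [hl k hk hD, sigma2_conj_lower] at this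
        simpa only [firstPole, firstCoeff, if_pos hk, if_neg hD] using this
  · intro h
    refine ⟨by have := h.analytic; rwa [poleSet_firstPole] at this, h.normalized, fun k hk => ?_,
      fun k hk => ?_⟩
    · by_cases hD : k ∈ D
      · rw [hu k hk hD]
        have := h.upper k hk
        simpa only [firstPole, firstCoeff, if_pos hk, if_pos hD, Complex.conj_conj, map_neg,
          neg_neg] using this
      · rw [hl k hk hD]
        have := h.lower k hk
        simpa only [firstPole, firstCoeff, if_pos hk, if_neg hD] using this
    · by_cases hD : k ∈ D
      · rw [hu k hk hD, sigma2_conj_upper]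
        have := h.lower k hk
        simpa only [firstPole, firstCoeff, if_pos hk, if_pos hD] using this
      · rw [hl k hk hD, sigma2_conj_lower]
        have := h.upper k hk
        simpa only [firstPole, firstCoeff, if_pos hk, if_neg hD] using this

theorem modifiedNorming_eq (z c : Fin N → ℂ) (J : Finset (Fin N)) (k : Fin N) :
    modifiedNorming z c J k = c k * blaschke z J (z k) ^ 2 := by
  rw [modifiedNorming, blaschke, Finset.prod_pow]

theorem differentiableAt_blaschke {z : Fin N → ℂ} (hIm : ∀ k, 0 < (z k).im)
    (D : Finset (Fin N)) (k : Fin N) : DifferentiableAt ℂ (blaschke z D) (z k) := by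
  unfold blaschke
  refine DifferentiableAt.fun_finsetProd fun j _ => ?_
  refine DifferentiableAt.div (by fun_prop) (by fun_prop) fun h => ?_
  have := congrArg Complex.im (sub_eq_zero.1 h)
  rw [Complex.conj_im] at this
  linarith [hIm j, hIm k]

theorem blaschke_eq_zero (z : Fin N → ℂ) {D : Finset (Fin N)} {k : Fin N} (hk : k ∈ D) :
    blaschke z D (z k) = 0 :=
  Finset.prod_eq_zero hk (by simp)

/-- The poles with index outside `K` enter the residue coefficients of the other ones through the
norming constants only. -/
theorem residueCoeff_inter (α γ x t : ℝ) {z : Fin N → ℂ} (c : Fin N → ℂ)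
    (hIm : ∀ k, 0 < (z k).im) (D : Finset (Fin N)) {K : Finset (Fin N)} {k : Fin N} (hk : k ∈ K) :
    residueCoeff α γ x t z (modifiedNorming z c (D \ K)) (D ∩ K) k =
      residueCoeff α γ x t z c D k := by
  have hfac : blaschke z D = fun w => blaschke z (D ∩ K) w * blaschke z (D \ K) w :=
    funext fun w => (Finset.prod_inter_mul_prod_sdiff D K _).symm
  have hiff : k ∈ D ∩ K ↔ k ∈ D := by simp [hk]
  simp only [residueCoeff, hiff, modifiedNorming_eq]
  split_ifs with hD
  · have hder : deriv (blaschke z D) (z k) =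
        deriv (blaschke z (D ∩ K)) (z k) * blaschke z (D \ K) (z k) := by
      rw [hfac, deriv_fun_mul (differentiableAt_blaschke hIm _ k)
        (differentiableAt_blaschke hIm _ k), blaschke_eq_zero z (hiff.2 hD), zero_mul, add_zero]
    rw [hder, mul_inv, mul_pow, mul_inv]
    ring
  · rw [hfac]
    ring

/-! ### Size of the residue coefficients in the cone -/

/-- The modulus of the residue coefficient without its exponential factor. -/
def amplitude (z c : Fin N → ℂ) (D : Finset (Fin N)) (k : Fin N) : ℝ :=
  if k ∈ D then ‖(c k)⁻¹ * ((deriv (blaschke z D) (z k)) ^ 2)⁻¹‖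
  else ‖c k * (blaschke z D (z k)) ^ 2‖

theorem amplitude_nonneg (z c : Fin N → ℂ) (D : Finset (Fin N)) (k : Fin N) :
    0 ≤ amplitude z c D k := by
  unfold amplitude
  split_ifs <;> exact norm_nonneg _

theorem re_phase (α γ x t : ℝ) (w : ℂ) :
    (2 * Complex.I * t * theta α γ x t w).re = -8 * (t * (w.re - statPoint α x t)) * w.im := by
  have hxt : (x : ℂ) / (t : ℂ) = ((x / t : ℝ) : ℂ) := by push_cast; rfl
  simp only [theta, statPoint, hxt, pow_two]
  have e : (γ : ℂ) / 2 = ((γ / 2 : ℝ) : ℂ) := by push_cast; rfl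
  rw [e]
  simp [Complex.mul_re, Complex.mul_im]
  ring

/-- The sign conditions say that `D` contains the poles whose exponential would grow and for which
it is inverted; hence the exponent is nonpositive in both cases. -/
theorem norm_residueCoeff (α γ x t : ℝ) (z c : Fin N → ℂ) (D : Finset (Fin N))
    (k : Fin N) (hD : k ∈ D → t * ((z k).re - statPoint α x t) ≤ 0)
    (hDc : k ∉ D → 0 ≤ t * ((z k).re - statPoint α x t)) :
    ‖residueCoeff α γ x t z c D k‖ =
      amplitude z c D k * Real.exp (-8 * (|t| * |(z k).re - statPoint α x t|) * (z k).im) := by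
  have hre := re_phase α γ x t (z k)
  rw [← abs_mul]
  unfold residueCoeff amplitude
  split_ifs with h
  · rw [norm_mul, Complex.norm_exp, abs_of_nonpos (hD h)]
    have e : -2 * Complex.I * t * theta α γ x t (z k) =
      -(2 * Complex.I * t * theta α γ x t (z k)) := by ring
    rw [e, Complex.neg_re, hre]
    congr 2
    ring
  · rw [norm_mul, Complex.norm_exp, abs_of_nonneg (hDc h), hre]

theorem exp_le_decay (z : Fin N → ℂ) (I : Set ℝ) (t : ℝ) {k : Fin N} (hk : k ∉ inside z I) :
    Real.exp (-8 * ((z k).im * Metric.infDist (z k).re I) * |t|) ≤ decay z I t := by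
  have hk' : k ∈ outside z I := by simpa [outside] using hk
  rw [decay, dif_pos ⟨k, hk'⟩, Real.exp_le_exp]
  have := Finset.inf'_le (fun k => (z k).im * Metric.infDist (z k).re I) hk'
  have := mul_le_mul_of_nonneg_right this (abs_nonneg t)
  linarith

theorem decay_nonneg (z : Fin N → ℂ) (I : Set ℝ) (t : ℝ) : 0 ≤ decay z I t := by
  unfold decay
  split_ifs
  · positivity
  · exact le_rfl

/-- In the cone the stationary point is at distance `O(1/t)` of the window. -/
theorem exists_mem_window (α : ℝ) {x₁ x₂ v₁ v₂ x t : ℝ} (ht : t ≠ 0)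
    (h : (x, t) ∈ cone x₁ x₂ v₁ v₂) : ∃ y ∈ window α v₁ v₂,
      |t| * |statPoint α x t - y| ≤ (|x₁| + |x₂|) / 4 := by
  obtain ⟨x₀, hx₀, v, hv, hx⟩ := h
  simp only at hx
  -- The stationary point of velocity `v` itself; the offset `x₀` displaces it by `-x₀ / (4 t)`.
  refine ⟨-(v + α) / 4, ⟨by linarith [hv.2], by linarith [hv.1]⟩, ?_⟩
  have e : t * (statPoint α x t - -(v + α) / 4) = -x₀ / 4 := by
    rw [statPoint, hx]
    field_simp
    ring
  rw [← abs_mul, e, abs_div, abs_neg, abs_of_pos (four_pos : (0 : ℝ) < 4)]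
  have : |x₀| ≤ |x₁| + |x₂| := by
    rw [abs_le]
    constructor
    · linarith [hx₀.1, neg_abs_le x₁, abs_nonneg x₂]
    · linarith [hx₀.2, le_abs_self x₂, abs_nonneg x₁]
  linarith

theorem infDist_le_statPoint (α : ℝ) {x₁ x₂ v₁ v₂ x t : ℝ} (ht : t ≠ 0)
    (h : (x, t) ∈ cone x₁ x₂ v₁ v₂) (a : ℝ) :
    |t| * Metric.infDist a (window α v₁ v₂) ≤
      |t| * |a - statPoint α x t| + (|x₁| + |x₂|) / 4 := by
  obtain ⟨y, hy, hyt⟩ := exists_mem_window α ht h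
  have h1 := Metric.infDist_le_dist_of_mem (x := a) hy
  rw [Real.dist_eq] at h1
  have h2 := abs_sub_le a (statPoint α x t) y
  have := mul_le_mul_of_nonneg_left (h1.trans h2) (abs_nonneg t)
  linarith

/-- Reduction to the poles in the window for a fixed normalization `D` that is adapted to the
sign of the phase. -/
theorem exists_reducesTo (α γ : ℝ) {z : Fin N → ℂ} (c : Fin N → ℂ) (hz : Function.Injective z)
    (hIm : ∀ k, 0 < (z k).im) (x₁ x₂ v₁ v₂ : ℝ) {r : ℝ} (hr : 0 < r) (D : Finset (Fin N)) :
    ∃ C : ℝ, ∀ x t : ℝ, (x, t) ∈ cone x₁ x₂ v₁ v₂ → t ≠ 0 →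
      (∀ k ∈ D, t * ((z k).re - statPoint α x t) ≤ 0) →
      (∀ k ∉ D, 0 ≤ t * ((z k).re - statPoint α x t)) →
      ReducesTo α γ x t z c D (window α v₁ v₂)
        (modifiedNorming z c (D \ inside z (window α v₁ v₂))) r
        (C * decay z (window α v₁ v₂) t) := by
  have hp := separated_firstPole hz hIm D
  set K := inside z (window α v₁ v₂) with hK
  -- The sum of the amplitudes bounds all coefficients at all times, since the exponentials are at
  -- most 1.
  obtain ⟨C, hC⟩ := exists_reduction_bound hp K (∑ k, amplitude z c D k) hr
  set X := |x₁| + |x₂| with hX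
  -- The factor `exp (2 X Im z_k)` pays for replacing the distance to the stationary point by the
  -- distance to the window: `|t|` times the error is at most `X / 4`, and `8 · X / 4 = 2 X`.
  set G := ∑ k, amplitude z c D k * Real.exp (2 * X * (z k).im) with hG
  refine ⟨C * G, fun x t hxt ht hD hDc => ?_⟩
  have hamp := amplitude_nonneg z c D
  have hnorm : ∀ k, ‖firstCoeff α γ x t z c Finset.univ D k‖ =
      amplitude z c D k * Real.exp (-8 * (|t| * |(z k).re - statPoint α x t|) * (z k).im) := by
    intro k
    rw [← norm_residueCoeff α γ x t z c D k (hD k) (hDc k)]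
    simp only [firstCoeff, Finset.mem_univ, if_true, Finset.inter_univ]
    split_ifs
    · rw [norm_neg, RCLike.norm_conj]
    · rfl
  have hzero : ∀ k ∉ K, firstCoeff α γ x t z (modifiedNorming z c (D \ K)) K D k = 0 :=
    fun k hk => if_neg hk
  refine ⟨?_, ?_, ?_⟩
  · obtain ⟨M, hM⟩ := exists_solvesPoles (η := firstCoeff α γ x t z c Finset.univ D) hp
      (K := Finset.univ) (by simp)
    exact ⟨M, by simpa using (isSolution_iff α γ x t z c Finset.univ D M).2 hM⟩
  · obtain ⟨M, hM⟩ := exists_solvesPoles hp hzero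
    exact ⟨M, (isSolution_iff α γ x t z _ K D M).2 hM⟩
  · intro M M' hM hM' w hw
    rw [isSolution_iff] at hM'
    have hMu := (isSolution_iff α γ x t z c Finset.univ D M).1 (by simpa using hM)
    rw [mul_assoc]
    refine hC _ _ ?_ ?_ hzero _ ?_ ?_ M M' hMu hM' w (by rwa [awayFrom_firstPole])
    · refine (pi_norm_le_iff_of_nonneg (Finset.sum_nonneg fun k _ => hamp k)).2 fun k => ?_
      rw [hnorm]
      refine le_trans ?_ (Finset.single_le_sum (fun k _ => hamp k) (Finset.mem_univ k))
      refine mul_le_of_le_one_right (hamp k) (Real.exp_le_one_iff.2 ?_)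
      have := mul_nonneg (mul_nonneg (abs_nonneg t) (abs_nonneg ((z k).re - statPoint α x t)))
        (hIm k).le
      linarith
    · intro k hk
      simp only [firstCoeff, hk, Finset.mem_univ, if_true, Finset.inter_univ,
        residueCoeff_inter α γ x t c hIm D hk]
    · exact mul_nonneg (Finset.sum_nonneg fun k _ => mul_nonneg (hamp k) (Real.exp_nonneg _))
        (decay_nonneg _ _ _)
    · intro k hk
      rw [hnorm]
      have h1 := exp_le_decay z (window α v₁ v₂) t hk
      have h2 := infDist_le_statPoint α ht hxt (z k).re
      have h3 : Real.exp (-8 * (|t| * |(z k).re - statPoint α x t|) * (z k).im) ≤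
          Real.exp (2 * X * (z k).im) * decay z (window α v₁ v₂) t := by
        refine le_trans ?_ (mul_le_mul_of_nonneg_left h1 (Real.exp_nonneg _))
        rw [← Real.exp_add, Real.exp_le_exp]
        have := mul_le_mul_of_nonneg_right h2 (hIm k).le
        rw [← hX] at this
        nlinarith
      calc _ ≤ amplitude z c D k *
            (Real.exp (2 * X * (z k).im) * decay z (window α v₁ v₂) t) :=
            mul_le_mul_of_nonneg_left h3 (hamp k)
        _ = (amplitude z c D k * Real.exp (2 * X * (z k).im)) * decay z (window α v₁ v₂) t := by
            ring
        _ ≤ G * decay z (window α v₁ v₂) t :=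
            mul_le_mul_of_nonneg_right (Finset.single_le_sum
              (f := fun k => amplitude z c D k * Real.exp (2 * X * (z k).im))
              (fun k _ => mul_nonneg (hamp k) (Real.exp_nonneg _)) (Finset.mem_univ k))
              (decay_nonneg _ _ _)

theorem ReducesTo.mono {α γ x t : ℝ} {z c : Fin N → ℂ} {D : Finset (Fin N)} {I : Set ℝ}
    {c' : Fin N → ℂ} {r ε ε' : ℝ} (h : ReducesTo α γ x t z c D I c' r ε) (hε : ε ≤ ε') :
    ReducesTo α γ x t z c D I c' r ε' :=
  ⟨h.1, h.2.1, fun M M' hM hM' w hw =>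
    let ⟨E, hE, hw'⟩ := h.2.2 M M' hM hM' w hw
    ⟨E, fun i j => (hE i j).trans hε, hw'⟩⟩

/-- Reduction to the poles in the window, uniformly in the adapted normalization. -/
theorem exists_reducesTo_uniform (α γ : ℝ) {z : Fin N → ℂ} (c : Fin N → ℂ)
    (hz : Function.Injective z) (hIm : ∀ k, 0 < (z k).im) (x₁ x₂ v₁ v₂ : ℝ) {r : ℝ} (hr : 0 < r) :
    ∃ C : ℝ, ∀ x t : ℝ, (x, t) ∈ cone x₁ x₂ v₁ v₂ → t ≠ 0 → ∀ D : Finset (Fin N),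
      (∀ k ∈ D, t * ((z k).re - statPoint α x t) ≤ 0) →
      (∀ k ∉ D, 0 ≤ t * ((z k).re - statPoint α x t)) →
      ReducesTo α γ x t z c D (window α v₁ v₂)
        (modifiedNorming z c (D \ inside z (window α v₁ v₂))) r
        (C * decay z (window α v₁ v₂) t) := by
  choose C hC using exists_reducesTo α γ c hz hIm x₁ x₂ v₁ v₂ hr
  -- The adapted `D` moves with the stationary point, but there are only finitely many index sets.
  refine ⟨∑ D, |C D|, fun x t hxt ht D hD hDc => (hC D x t hxt ht hD hDc).mono ?_⟩
  refine mul_le_mul_of_nonneg_right ?_ (decay_nonneg _ _ _)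
  exact (le_abs_self _).trans
    (Finset.single_le_sum (f := fun D => |C D|) (fun _ _ => abs_nonneg _) (Finset.mem_univ D))

/-- For large `|t|` the stationary point lies on the same side of a pole outside the window as the
whole window. -/
theorem exists_large_time (α : ℝ) (z : Fin N → ℂ) (x₁ x₂ : ℝ) {v₁ v₂ : ℝ} (hv : v₁ ≤ v₂) :
    ∃ T > 0, ∀ x t : ℝ, (x, t) ∈ cone x₁ x₂ v₁ v₂ → T ≤ |t| → ∀ k,
      ((z k).re < -(v₂ + α) / 4 → (z k).re < statPoint α x t) ∧
      (-(v₁ + α) / 4 < (z k).re → statPoint α x t < (z k).re) := by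
  have hne : (window α v₁ v₂).Nonempty := Set.nonempty_Icc.2 (by linarith)
  have hX : 0 ≤ |x₁| + |x₂| := by positivity
  set X := |x₁| + |x₂| with hXdef
  -- Beyond this time the stationary point is closer to a point of the window than any outside pole
  -- is. The summand 1 makes the inequality strict; poles in the window add `X / 0 = 0`.
  refine ⟨1 + ∑ k, X / Metric.infDist (z k).re (window α v₁ v₂), ?_, fun x t hxt hT k => ?_⟩
  · exact add_pos_of_pos_of_nonneg one_pos
      (Finset.sum_nonneg fun k _ => div_nonneg hX Metric.infDist_nonneg)
  have hk := Finset.single_le_sum (f := fun k => X / Metric.infDist (z k).re (window α v₁ v₂))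
    (fun k _ => div_nonneg hX Metric.infDist_nonneg) (Finset.mem_univ k)
  have hk0 : 0 ≤ X / Metric.infDist (z k).re (window α v₁ v₂) :=
    div_nonneg hX Metric.infDist_nonneg
  have ht0 : 0 < |t| := by linarith
  obtain ⟨y, hy, hyt⟩ := exists_mem_window α (abs_pos.1 ht0) hxt
  have hd : Metric.infDist (z k).re (window α v₁ v₂) ≤ |(z k).re - y| :=
    Metric.infDist_le_dist_of_mem hy
  have main : (z k).re ∉ window α v₁ v₂ → |statPoint α x t - y| < |(z k).re - y| := by
    intro hout
    have hpos : 0 < Metric.infDist (z k).re (window α v₁ v₂) :=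
      (isClosed_Icc.notMem_iff_infDist_pos hne).1 hout
    have h1 : X / Metric.infDist (z k).re (window α v₁ v₂) < |t| := by linarith
    rw [div_lt_iff₀ hpos] at h1
    have h2 : |t| * |statPoint α x t - y| < |t| * |(z k).re - y| := by
      have := mul_le_mul_of_nonneg_left hd ht0.le
      rw [← hXdef] at hyt
      linarith
    exact lt_of_mul_lt_mul_left h2 ht0.le
  constructor
  · intro h
    have h1 := main fun h' => (h'.1.trans_lt h).false
    rw [abs_of_neg (by linarith [hy.1] : (z k).re - y < 0)] at h1
    linarith [neg_abs_le (statPoint α x t - y)]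
  · intro h
    have h1 := main fun h' => (h.trans_le h'.2).false
    rw [abs_of_pos (by linarith [hy.2] : 0 < (z k).re - y)] at h1
    linarith [le_abs_self (statPoint α x t - y)]

end Reduction

end CGNLS

end

/-! ### The two time directions -/

theorem proposition6p3 (α γ : ℝ) {N : ℕ} (z c : Fin N → ℂ)
    (hz : Function.Injective z) (hIm : ∀ k, 0 < (z k).im) (hc : ∀ k, c k ≠ 0)
    (x₁ x₂ v₁ v₂ : ℝ) (hx : x₁ < x₂) (hv : v₁ < v₂) :
    -- as `t → +∞` in the cone
    (∃ T > 0, ∀ r > 0, ∃ C : ℝ, ∀ x t : ℝ, (x, t) ∈ CGNLS.cone x₁ x₂ v₁ v₂ → T ≤ t →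
      CGNLS.ReducesTo α γ x t z c
        (CGNLS.leftOf z (CGNLS.statPoint α x t)) (CGNLS.window α v₁ v₂)
        (CGNLS.modifiedNorming z c (CGNLS.leftOf z (-(v₂ + α) / 4)))
        r (C * CGNLS.decay z (CGNLS.window α v₁ v₂) t)) ∧
    -- as `t → -∞` in the cone
    (∃ T > 0, ∀ r > 0, ∃ C : ℝ, ∀ x t : ℝ, (x, t) ∈ CGNLS.cone x₁ x₂ v₁ v₂ → t ≤ -T →
      CGNLS.ReducesTo α γ x t z c
        (CGNLS.rightOf z (CGNLS.statPoint α x t)) (CGNLS.window α v₁ v₂)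
        (CGNLS.modifiedNorming z c (CGNLS.rightOf z (-(v₁ + α) / 4)))
        r (C * CGNLS.decay z (CGNLS.window α v₁ v₂) t)) := by
  obtain ⟨T, hT, hside⟩ := CGNLS.exists_large_time α z x₁ x₂ hv.le
  refine ⟨⟨T, hT, fun r hr => ?_⟩, ⟨T, hT, fun r hr => ?_⟩⟩
  · obtain ⟨C, hC⟩ := CGNLS.exists_reducesTo_uniform α γ c hz hIm x₁ x₂ v₁ v₂ hr
    refine ⟨C, fun x t hxt ht => ?_⟩
    have ht0 : 0 < t := hT.trans_le ht
    have hs := hside x t hxt (ht.trans (le_abs_self t))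
    -- For large times the discarded part of the moving index set no longer depends on `(x, t)`.
    have hD : CGNLS.leftOf z (CGNLS.statPoint α x t) \ CGNLS.inside z (CGNLS.window α v₁ v₂) =
        CGNLS.leftOf z (-(v₂ + α) / 4) := by
      ext k
      simp only [CGNLS.leftOf, CGNLS.inside, CGNLS.window, Finset.mem_sdiff, Finset.mem_filter,
        Finset.mem_univ, true_and, Set.mem_Icc, not_and, not_le]
      constructor
      · rintro ⟨h1, h2⟩
        by_contra! h3
        exact (h1.trans ((hs k).2 (h2 h3))).false
      · exact fun h => ⟨(hs k).1 h, fun h' => absurd h h'.not_gt⟩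
    rw [← hD]
    -- A pole with real part equal to the stationary point is not in `D`; the adapted sign
    -- conditions are not strict and allow this.
    refine hC x t hxt ht0.ne' _ (fun k hk => ?_) fun k hk => ?_
    · simp only [CGNLS.leftOf, Finset.mem_filter, Finset.mem_univ, true_and] at hk
      exact mul_nonpos_of_nonneg_of_nonpos ht0.le (by linarith)
    · simp only [CGNLS.leftOf, Finset.mem_filter, Finset.mem_univ, true_and, not_lt] at hk
      exact mul_nonneg ht0.le (by linarith)
  · obtain ⟨C, hC⟩ := CGNLS.exists_reducesTo_uniform α γ c hz hIm x₁ x₂ v₁ v₂ hr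
    refine ⟨C, fun x t hxt ht => ?_⟩
    have ht0 : t < 0 := by linarith
    have hs := hside x t hxt ((le_neg.2 ht).trans (neg_le_abs t))
    have hD : CGNLS.rightOf z (CGNLS.statPoint α x t) \ CGNLS.inside z (CGNLS.window α v₁ v₂) =
        CGNLS.rightOf z (-(v₁ + α) / 4) := by
      ext k
      simp only [CGNLS.rightOf, CGNLS.inside, CGNLS.window, Finset.mem_sdiff, Finset.mem_filter,
        Finset.mem_univ, true_and, Set.mem_Icc, not_and, not_le]
      constructor
      · rintro ⟨h1, h2⟩
        exact h2 (le_of_not_gt fun h3 => (h1.trans ((hs k).1 h3)).false)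
      · refine fun h => ⟨(hs k).2 h, fun _ => h⟩
    rw [← hD]
    -- With `t < 0` the growing exponentials belong to the poles on the right.
    refine hC x t hxt ht0.ne _ (fun k hk => ?_) fun k hk => ?_
    · simp only [CGNLS.rightOf, Finset.mem_filter, Finset.mem_univ, true_and] at hk
      exact mul_nonpos_of_nonpos_of_nonneg ht0.le (by linarith)
    · simp only [CGNLS.rightOf, Finset.mem_filter, Finset.mem_univ, true_and, not_lt] at hk
      exact mul_nonneg_of_nonpos_of_nonpos ht0.le (by linarith)
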